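/- Let $k\ge 1$ and $a\ge 2$ be integers and write $[k]=\{1,\dots,k\}$, with indices taken cyclically mod $k$. Put $c=\frac a\pi\sin\frac\pi a$ and, for $x\ge 0$, $$f_\Xi(x)=\frac{c}{1+x^a},\qquad f_\Theta(x)=\frac{c\,x^{a-2}}{1+x^a},\qquad \psi(t)=\int_0^t f_\Xi(x)\,dx,\qquad \phi(t)=\int_0^t f_\Theta(x)\,dx .$$ For a tuple $r=(r_1,\dots,r_n)\in[k]^n$ let $\alpha_j$ be the number of $z\in[k]$ that are cyclically adjacent mod $k$ to $r_j$ (that is, $z\equiv r_j\pm1$) but to none of $r_1,\dots,r_{j-1}$, and put $$J_{r_1\dots r_n}=\psi(1)^{\,k-n-\sum_j\alpha_j}\int_{1\le x_n\le\dots\le x_1}\ \prod_{j=1}^n f_\Xi(x_j)\,\psi(1/x_j)^{\alpha_j}\,dx_n\cdots dx_1,$$ $$K_{r_1\dots r_n}=\phi(1)^{\,k-n-\sum_j\alpha_j}\int_{1\le x_n\le\dots\le x_1}\ \prod_{j=1}^n f_\Theta(x_j)\,\phi(1/x_j)^{\alpha_j}\,dx_n\cdots dx_1 .$$ Define $$G(k,a)=\Bigl(\int_0^1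 f_\Xi(x)\,dx\Bigr)^k+\Bigl(\int_0^1 f_\Theta(x)\,dx\Bigr)^k+\sum_{n=1}^{\lfloor k/2\rfloor}\ \sum_{\substack{(r_1,\dots,r_n)\in[k]^n\\ |r_i-r_j|\notin\{0,1,k-1\}\ (i\ne j)}}\bigl(J_{r_1\dots r_n}+K_{r_1\dots r_n}\bigr).$$ Then $$S(k,a):=\sum_{n\in\mathbb Z}\frac{(-1)^{nk}}{(an+1)^k}=\Bigl(\frac\pi a\csc\frac\pi a\Bigr)^k\,G(k,a),$$ where the series is understood as the limit of $\sum_{n=-M}^{N}$ as $M,N\to\infty$ independently, and converges unconditionally when $k\ge2$. Moreover, if $\Xi_1,\dots,\Xi_k$ are independent with common density $f_\Xi$ on $[0,\infty)$ and $\Theta_1,\dots,\Theta_k$ are independent with common density $f_\Theta$ on $[0,\infty)$, then $$\Pr\bigl(\Xi_i\Xi_{i+1}<1\text{ for all }i\in[k]\bigr)+\Pr\bigl(\Theta_i\Theta_{i+1}<1\text{ for all }i\in[k]\bigr)=G(k,a),$$ where $\Xi_{k+1}=\Xi_1$ and $\Theta_{k+1}=\Theta_1$. -/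

import Mathlib

open MeasureTheory Filter Topology

noncomputable section

/-- The general term of the bilateral series `S(k,a)`. -/
def seriesTerm (k a : ℕ) (n : ℤ) : ℝ :=
  (-1 : ℝ) ^ (n * (k : ℤ)) / ((a : ℝ) * (n : ℝ) + 1) ^ k

/-- The density of the variables `Ξ_i` on `[0, ∞)`. -/
def fXi (a : ℕ) (x : ℝ) : ℝ :=
  ((a : ℝ) / Real.pi * Real.sin (Real.pi / a)) / (1 + x ^ a)

/-- The density of the variables `Θ_i` on `[0, ∞)`; it is used for `2 ≤ a` only. -/
def fTheta (a : ℕ) (x : ℝ) : ℝ :=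
  ((a : ℝ) / Real.pi * Real.sin (Real.pi / a) * x ^ (a - 2)) / (1 + x ^ a)

/-- The distribution function of the law on `[0, ∞)` with density `f`; it is `ψ` for `f = fXi a`
and `φ` for `f = fTheta a`. -/
def cdfOf (f : ℝ → ℝ) (t : ℝ) : ℝ :=
  ∫ x in (0 : ℝ)..t, f x

/-- The law on the real line that has density `f` on `[0, ∞)`. -/
def lawOf (f : ℝ → ℝ) : Measure ℝ :=
  (volume.restrict (Set.Ici (0 : ℝ))).withDensity fun x => ENNReal.ofReal (f x)

/-- The probability that `X_i * X_{i+1} < 1` for every `i`, the indices being cyclic mod `k`,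
where `X_1, …, X_k` are independent with common density `f` on `[0, ∞)`. -/
def probPolytope (k : ℕ) (f : ℝ → ℝ) : ℝ :=
  (Measure.pi fun _ : Fin k => lawOf f).real {x | ∀ i, x i * x (finRotate k i) < 1}

/-- The tuples `(r_1, …, r_n)` in `[k]^n` with `|r_i - r_j| ∉ {0, 1, k - 1}` for `i ≠ j`. -/
def nonconsecTuples (k n : ℕ) : Finset (Fin n → Fin k) :=
  {r | ∀ i j, i ≠ j → |(r i : ℤ) - (r j : ℤ)| ∉ ({0, 1, (k : ℤ) - 1} : Finset ℤ)}

/-- `z` is one of the two (possibly equal) cyclic neighbours `r + 1`, `r - 1` of `r` mod `k`. -/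
def IsCyclicNeighbor {k : ℕ} (z r : Fin k) : Prop :=
  z = finRotate k r ∨ finRotate k z = r

open Classical in
/-- The number of cyclic neighbours `z` of `r_j` whose constraint is `X_z < 1 / X_{r_j}` when
`1 ≤ X_{r_n} ≤ … ≤ X_{r_1}`. As the supremum of `X_z` is the least of the `1 / X_{r_m}` with
`r_m` adjacent to `z`, these are the neighbours of `r_j` not adjacent to any earlier `r_m`. -/
def alpha {k n : ℕ} (r : Fin n → Fin k) (j : Fin n) : ℕ :=
  Finset.card {z : Fin k | IsCyclicNeighbor z (r j) ∧ ∀ m, m < j → ¬ IsCyclicNeighbor z (r m)}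

/-- The integral over `1 ≤ x_n ≤ … ≤ x_1` attached to the tuple `r` and the density `f`:
it is `J_{r_1 … r_n}` for `f = fXi a` and `K_{r_1 … r_n}` for `f = fTheta a`.
For `r ∈ nonconsecTuples k n` with `n ≤ k / 2`, the numbers `alpha r j` add up to the number
of indices adjacent to some `r_j`, none of which is an `r_j`; so no subtraction is truncated. -/
def tupleIntegral {k n : ℕ} (f : ℝ → ℝ) (r : Fin n → Fin k) : ℝ :=
  cdfOf f 1 ^ (k - n - ∑ j, alpha r j) *
    ∫ x in {x : Fin n → ℝ | (∀ j, 1 ≤ x j) ∧ Antitone x},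
      ∏ j, f (x j) * cdfOf f (1 / x j) ^ alpha r j

/-- The sum of the two `k`-th powers and of all `J + K`. -/
def giganticSum (k a : ℕ) : ℝ :=
  (∫ x in (0 : ℝ)..1, fXi a x) ^ k + (∫ x in (0 : ℝ)..1, fTheta a x) ^ k +
    ∑ n ∈ Finset.Icc 1 (k / 2), ∑ r ∈ nonconsecTuples k n,
      (tupleIntegral (fXi a) r + tupleIntegral (fTheta a) r)

end

/-!
Both halves of the bilateral series are geometric series in disguise. Since
`1 / (m + 1) = ∫ t in 0..1, t ^ m`, the terms with `n ≥ 0` sum to the integral over the unit cube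
of `1 / (1 - (-1) ^ k * ∏ x i ^ a)`, and those with `n < 0` to the integral of the same kernel
weighted by `∏ x i ^ (a - 2)`; dominated convergence also covers the conditionally convergent case
`k = 1` (`tendsto_sum_range_integral_cubeKernel`).

The substitution `x i = ξ i * ((1 + ξ (i + 1) ^ a) / (1 + ξ i ^ a)) ^ (1 / a)` maps the polytope
`ξ i * ξ (i + 1) < 1` of the positive orthant bijectively onto the open unit cube (`injOn_toCube`,
`image_toCube`): with `u = ξ ^ a / (1 + ξ ^ a)` and `y = x ^ a` it reads
`u i = y i * (1 - u (i + 1))`, a cyclic linear system with exactly one solution, and that solution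
lies in `(0, 1)`. Its Jacobian matrix is a diagonal plus a weighted cyclic permutation, with
determinant `∏ 1 / (1 + ξ i ^ a) * (1 - (-1) ^ k * ∏ ξ i ^ a)` (`det_toCubeJacobian`). As the
substitution preserves the product of the coordinates, the second factor is the denominator of the
kernel, and what remains is the joint density of the `Ξ i`, respectively of the `Θ i`, up to the
normalizing constant (`lintegral_cube_eq_lintegral_openPolytope`).

The probability of the polytope is then computed for any density on `[0, ∞)`
(`probPolytope_eq_sum`). Almost surely the coordinates are positive and distinct, so the polytope
splits according to the positions `r` of the coordinates that are at least `1`, listed in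
decreasing order of the coordinates. No two such positions are adjacent, hence there are at most
`k / 2` of them; given these coordinates, each remaining one is subject to a single upper bound:
the reciprocal of the largest adjacent coordinate in the list, or `1`. Fubini's theorem turns each
part into `tupleIntegral f r`.
-/

noncomputable section

/-! ### Independent variables with a density on the half-line -/

/-- A finite product of a measure with a real density has the product density. -/
lemma pi_withDensity_ofReal {ι : Type*} [Fintype ι] (ν : Measure ℝ) [SigmaFinite ν] {f : ℝ → ℝ}
    (hf : Integrable f ν) :
    (Measure.pi fun _ : ι => ν.withDensity fun x => ENNReal.ofReal (f x)) =
      (Measure.pi fun _ : ι => ν).withDensity fun x => ∏ i, ENNReal.ofReal (f (x i)) := by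
  have hfin : IsFiniteMeasure (ν.withDensity fun x => ENNReal.ofReal (f x)) :=
    isFiniteMeasure_withDensity_ofReal hf.2
  refine Measure.pi_eq fun s hs => ?_
  rw [withDensity_apply _ (MeasurableSet.univ_pi hs), Measure.restrict_pi_pi]
  have hpos : Integrable (fun x => max (f x) 0) ν := hf.pos_part
  have hprod : ∀ x : ι → ℝ, ∏ i, ENNReal.ofReal (f (x i)) =
      ENNReal.ofReal (∏ i, max (f (x i)) 0) := fun x => by
    rw [ENNReal.ofReal_prod_of_nonneg fun i _ => le_max_right _ _]
    simp
  have hnn : ∀ i, 0 ≤ ∫ y in s i, max (f y) 0 ∂ν := fun i =>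
    integral_nonneg fun y => le_max_right _ _
  -- The Bochner version of Fubini's theorem for products applies to the positive part of `f`.
  simp_rw [hprod]
  rw [← ofReal_integral_eq_lintegral_ofReal
      (Integrable.fintype_prod_dep fun i => hpos.restrict (s := s i))
      (Eventually.of_forall fun x => Finset.prod_nonneg fun i _ => le_max_right _ _)]
  rw [integral_fintype_prod_eq_prod (μ := fun i => ν.restrict (s i)) (fun _ y => max (f y) 0),
    ENNReal.ofReal_prod_of_nonneg fun i _ => hnn i]
  refine Finset.prod_congr rfl fun i _ => ?_
  rw [ofReal_integral_eq_lintegral_ofReal hpos.restrict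
      (Eventually.of_forall fun x => le_max_right _ _), withDensity_apply _ (hs i)]
  simp

lemma lawOf_eq_Ioi (f : ℝ → ℝ) :
    lawOf f = (volume.restrict (Set.Ioi (0 : ℝ))).withDensity fun x => ENNReal.ofReal (f x) := by
  rw [lawOf, Measure.restrict_congr_set Ioi_ae_eq_Ici]

lemma isFiniteMeasure_lawOf {f : ℝ → ℝ} (hf : IntegrableOn f (Set.Ioi 0)) :
    IsFiniteMeasure (lawOf f) := by
  rw [lawOf_eq_Ioi]
  exact isFiniteMeasure_withDensity_ofReal hf.2

/-- Independent variables with common density `f` on `[0, ∞)` have the joint density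
`∏ i, f (x i)` on the open orthant. -/
lemma pi_lawOf {ι : Type*} [Fintype ι] {f : ℝ → ℝ}
    (hf : IntegrableOn f (Set.Ioi 0)) :
    (Measure.pi fun _ : ι => lawOf f) =
      (volume.restrict (Set.univ.pi fun _ : ι => Set.Ioi (0 : ℝ))).withDensity
        fun x => ∏ i, ENNReal.ofReal (f (x i)) := by
  simp_rw [lawOf_eq_Ioi]
  rw [pi_withDensity_ofReal _ hf, volume_pi, Measure.restrict_pi_pi]

/-- The law with density `f` has no atoms, so `cdfOf f t` is the mass of the open half-line. -/
lemma lawOf_Iio {f : ℝ → ℝ} (h0 : ∀ x, 0 < x → 0 ≤ f x) (hf : IntegrableOn f (Set.Ioi 0))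
    {t : ℝ} (ht : 0 ≤ t) : lawOf f (Set.Iio t) = ENNReal.ofReal (cdfOf f t) := by
  rw [lawOf_eq_Ioi, withDensity_apply _ measurableSet_Iio, Measure.restrict_restrict
    measurableSet_Iio, Set.Iio_inter_Ioi, cdfOf, intervalIntegral.integral_of_le ht,
    integral_Ioc_eq_integral_Ioo]
  refine (ofReal_integral_eq_lintegral_ofReal (hf.mono_set fun x hx => hx.1) ?_).symm
  exact (ae_restrict_mem measurableSet_Ioo).mono fun x hx => h0 x hx.1

lemma cdfOf_nonneg {f : ℝ → ℝ} (h0 : ∀ x, 0 < x → 0 ≤ f x) {t : ℝ} (ht : 0 ≤ t) :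
    0 ≤ cdfOf f t := by
  rw [cdfOf, intervalIntegral.integral_of_le ht]
  exact setIntegral_nonneg measurableSet_Ioc fun x hx => h0 x hx.1

lemma ae_pos_pi_lawOf {ι : Type*} [Fintype ι] {f : ℝ → ℝ}
    (hf : IntegrableOn f (Set.Ioi 0)) :
    ∀ᵐ x ∂(Measure.pi fun _ : ι => lawOf f), ∀ i, 0 < x i := by
  rw [pi_lawOf hf]
  refine (withDensity_absolutelyContinuous _ _).ae_le ?_
  filter_upwards [ae_restrict_mem (MeasurableSet.univ_pi fun _ => measurableSet_Ioi)] with x hx i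
  exact hx i trivial

lemma ae_injective_pi_lawOf {ι : Type*} [Fintype ι] {f : ℝ → ℝ}
    (hf : IntegrableOn f (Set.Ioi 0)) :
    ∀ᵐ x ∂(Measure.pi fun _ : ι => lawOf f), Function.Injective x := by
  classical
  rw [pi_lawOf hf]
  refine ((withDensity_absolutelyContinuous _ _).trans
    Measure.restrict_le_self.absolutelyContinuous).ae_le ?_
  have key : ∀ i j : ι, i ≠ j → ∀ᵐ x : ι → ℝ, x i ≠ x j := fun i j hij => by
    set L : (ι → ℝ) →ₗ[ℝ] ℝ :=
      (LinearMap.proj i : (ι → ℝ) →ₗ[ℝ] ℝ) - LinearMap.proj j with hL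
    have hne : LinearMap.ker L ≠ ⊤ := fun h => by
      have h1 : (Pi.single i 1 : ι → ℝ) ∈ LinearMap.ker L := h ▸ trivial
      simp [hL, hij.symm] at h1
    have := Measure.addHaar_submodule (volume : Measure (ι → ℝ)) _ hne
    refine measure_mono_null (fun x hx => ?_) this
    simpa [hL, sub_eq_zero] using hx
  have : ∀ᵐ x : ι → ℝ, ∀ i j, i ≠ j → x i ≠ x j := by
    simp only [ae_all_iff]
    exact key
  filter_upwards [this] with x hx i j h
  by_contra hne
  exact hx i j hne h

/-! ### Splitting the polytope by the large coordinates -/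

/-- The condition on differences that defines `nonconsecTuples` says that the entries are distinct
and no two of them are cyclic neighbours. -/
lemma abs_sub_notMem_iff {k : ℕ} (u v : Fin k) :
    |(u : ℤ) - (v : ℤ)| ∉ ({0, 1, (k : ℤ) - 1} : Finset ℤ) ↔
      u ≠ v ∧ ¬ IsCyclicNeighbor u v := by
  rcases k with _ | m
  · exact u.elim0
  have hu := u.2
  have hv := v.2
  have e1 : ((u + 1 : Fin (m + 1)) : ℕ) = if (u : ℕ) = m then 0 else (u : ℕ) + 1 := by
    rw [Fin.val_add_one]; simp [Fin.ext_iff]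
  have e2 : ((v + 1 : Fin (m + 1)) : ℕ) = if (v : ℕ) = m then 0 else (v : ℕ) + 1 := by
    rw [Fin.val_add_one]; simp [Fin.ext_iff]
  simp only [IsCyclicNeighbor, finRotate_apply, Finset.mem_insert, Finset.mem_singleton, ne_eq,
    Fin.ext_iff, e1, e2]
  rcases abs_cases ((u : ℤ) - (v : ℤ)) with ⟨h, _⟩ | ⟨h, _⟩ <;> rw [h] <;> push_cast <;>
    split_ifs <;> omega

lemma mem_nonconsecTuples {k n : ℕ} {r : Fin n → Fin k} :
    r ∈ nonconsecTuples k n ↔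
      ∀ i j, i ≠ j → r i ≠ r j ∧ ¬ IsCyclicNeighbor (r i) (r j) := by
  simp only [nonconsecTuples, Finset.mem_filter, Finset.mem_univ, true_and]
  exact forall₃_congr fun i j _ => abs_sub_notMem_iff _ _

lemma not_isCyclicNeighbor_self {k : ℕ} (hk : 2 ≤ k) (u : Fin k) : ¬ IsCyclicNeighbor u u := by
  obtain ⟨m, rfl⟩ : ∃ m, k = m + 1 := ⟨k - 1, by omega⟩
  have e1 : ((u + 1 : Fin (m + 1)) : ℕ) = if (u : ℕ) = m then 0 else (u : ℕ) + 1 := by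
    rw [Fin.val_add_one]; simp [Fin.ext_iff]
  simp only [IsCyclicNeighbor, finRotate_apply, Fin.ext_iff, e1]
  have := u.2
  split_ifs <;> omega

/-- The part of the polytope on which the coordinates that are at least `1` are, in decreasing
order, those at the positions `r 0, r 1, …`. -/
def sortedRegion {k n : ℕ} (r : Fin n → Fin k) : Set (Fin k → ℝ) :=
  {x | (∀ i, 0 < x i) ∧ (∀ i, x i * x (finRotate k i) < 1) ∧ (∀ j, 1 ≤ x (r j)) ∧
    StrictAnti (x ∘ r) ∧ ∀ z, z ∉ Set.range r → x z < 1}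

lemma measurableSet_strictAnti_comp {α : Type*} {n : ℕ} (r : Fin n → α) :
    MeasurableSet {x : α → ℝ | StrictAnti (x ∘ r)} := by
  have : {x : α → ℝ | StrictAnti (x ∘ r)} =
      ⋂ (i : Fin n) (j : Fin n) (_ : i < j), {x | x (r j) < x (r i)} := by
    ext x
    simp only [Set.mem_ofPred_eq, Set.mem_iInter]
    exact ⟨fun h i j hij => h hij, fun h i j hij => h i j hij⟩
  rw [this]
  exact MeasurableSet.iInter fun i => .iInter fun j => .iInter fun _ =>
    measurableSet_lt (measurable_pi_apply _) (measurable_pi_apply _)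

lemma measurableSet_sortedRegion {k n : ℕ} (r : Fin n → Fin k) :
    MeasurableSet (sortedRegion r) := by
  have h1 : MeasurableSet {x : Fin k → ℝ | ∀ i, 0 < x i} := by
    simp only [Set.ofPred_forall]
    exact .iInter fun i => measurableSet_lt measurable_const (measurable_pi_apply _)
  have h2 : MeasurableSet {x : Fin k → ℝ | ∀ i, x i * x (finRotate k i) < 1} := by
    simp only [Set.ofPred_forall]
    exact .iInter fun i =>
      measurableSet_lt (by fun_prop : Measurable fun x : Fin k → ℝ => x i * x (finRotate k i))
        measurable_const
  have h3 : MeasurableSet {x : Fin k → ℝ | ∀ j, 1 ≤ x (r j)} := by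
    simp only [Set.ofPred_forall]
    exact .iInter fun i => measurableSet_le measurable_const (measurable_pi_apply _)
  have h4 : MeasurableSet {x : Fin k → ℝ | ∀ z, z ∉ Set.range r → x z < 1} := by
    simp only [Set.ofPred_forall]
    exact .iInter fun z => .iInter fun _ =>
      measurableSet_lt (measurable_pi_apply _) measurable_const
  exact h1.inter (h2.inter (h3.inter ((measurableSet_strictAnti_comp r).inter h4)))

lemma mem_nonconsecTuples_of_mem_sortedRegion {k n : ℕ} {r : Fin n → Fin k} {x : Fin k → ℝ}
    (hx : x ∈ sortedRegion r) : r ∈ nonconsecTuples k n := by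
  obtain ⟨-, hpoly, hge, hanti, -⟩ := hx
  refine mem_nonconsecTuples.2 fun i j hij => ⟨fun h => hij (hanti.injective ?_), ?_⟩
  · simp [h]
  · rintro (h | h)
    · have h1 := hpoly (r j)
      rw [← h] at h1
      nlinarith [hge i, hge j]
    · have h1 := hpoly (r i)
      rw [h] at h1
      nlinarith [hge i, hge j]

/-- The coordinates that are at least `1` determine the tuple of a region. -/
lemma sigma_eq_of_mem_sortedRegion {k n n' : ℕ} {r : Fin n → Fin k} {r' : Fin n' → Fin k}
    {x : Fin k → ℝ} (hx : x ∈ sortedRegion r) (hx' : x ∈ sortedRegion r') :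
    ∃ h : n = n', h ▸ r = r' := by
  have hrange : ∀ {m : ℕ} {s : Fin m → Fin k}, x ∈ sortedRegion s →
      Set.range s = {i | 1 ≤ x i} := fun {m s} hs => by
    ext i
    refine ⟨?_, fun hi => ?_⟩
    · rintro ⟨j, rfl⟩
      exact hs.2.2.1 j
    · by_contra h
      exact absurd (hs.2.2.2.2 i h) (not_lt.2 hi)
  have hanti := hx.2.2.2.1
  have hanti' := hx'.2.2.2.1
  have hrr := (hrange hx).trans (hrange hx').symm
  have hinj : Function.Injective r := hanti.injective.of_comp
  have hinj' : Function.Injective r' := hanti'.injective.of_comp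
  have hn : n = n' := by
    have h := congrArg Set.ncard hrr
    rwa [← Set.image_univ, ← Set.image_univ, Set.ncard_image_of_injective _ hinj,
      Set.ncard_image_of_injective _ hinj', Set.ncard_univ, Set.ncard_univ, Nat.card_fin,
      Nat.card_fin] at h
  subst hn
  refine ⟨rfl, ?_⟩
  have hcomp : x ∘ r = x ∘ r' := (hanti.range_inj hanti').1 (by
    rw [Set.range_comp, Set.range_comp, hrr])
  have hxinj : Set.InjOn x (Set.range r) := by
    rintro _ ⟨i, rfl⟩ _ ⟨j, rfl⟩ hij
    rw [hanti.injective hij]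
  funext j
  exact hxinj ⟨j, rfl⟩ (hrr ▸ ⟨j, rfl⟩) (congrFun hcomp j)

/-- A point of the polytope has at most `k / 2` coordinates that are at least `1`, since the
rotation sends their positions to positions of coordinates less than `1`. -/
lemma exists_mem_sortedRegion {k : ℕ} {x : Fin k → ℝ} (hpos : ∀ i, 0 < x i)
    (hinj : Function.Injective x) (hpoly : ∀ i, x i * x (finRotate k i) < 1) :
    ∃ n, n ≤ k / 2 ∧ ∃ r : Fin n → Fin k, x ∈ sortedRegion r := by
  classical
  set B : Finset (Fin k) := {i | 1 ≤ x i} with hB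
  have hcard : 2 * B.card ≤ k := by
    have h1 : (B.map (finRotate k).toEmbedding) ⊆ Bᶜ := fun z hz => by
      obtain ⟨i, hi, rfl⟩ := Finset.mem_map.1 hz
      simp only [hB, Finset.mem_filter, Finset.mem_univ, true_and] at hi
      simp only [hB, Finset.mem_compl, Finset.mem_filter, Finset.mem_univ, true_and, not_le,
        Equiv.coe_toEmbedding]
      by_contra! h
      nlinarith [hpoly i]
    have h2 := Finset.card_le_card h1
    rw [Finset.card_map, Finset.card_compl, Fintype.card_fin] at h2
    have := Finset.card_le_univ B
    rw [Fintype.card_fin] at this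
    omega
  set T : Finset ℝ := B.image x with hT
  have hTc : T.card = B.card := Finset.card_image_of_injective _ hinj
  have hmem : ∀ j : Fin B.card, ∃ i ∈ B, x i = T.orderEmbOfFin hTc j.rev := fun j =>
    Finset.mem_image.1 (T.orderEmbOfFin_mem hTc j.rev)
  choose r hrB hr using hmem
  refine ⟨B.card, by omega, r, hpos, hpoly, fun j => ?_, fun i j hij => ?_, fun z hz => ?_⟩
  · have := hrB j
    simpa [hB] using this
  · simp only [Function.comp_apply, hr]
    exact (T.orderEmbOfFin hTc).strictMono (Fin.rev_lt_rev.2 hij)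
  · by_contra! h
    have hzB : x z ∈ T := Finset.mem_image_of_mem _ (by simpa [hB] using h)
    rw [← Finset.mem_coe, ← T.range_orderEmbOfFin hTc] at hzB
    obtain ⟨j, hj⟩ := hzB
    exact hz ⟨j.rev, hinj (by rw [hr, Fin.rev_rev, hj])⟩

/-! ### Decoupling the constraints on a region -/

open Classical in
/-- The first position `j` such that `z` is a cyclic neighbour of `r j`, if there is one. -/
def firstNeighbor {k n : ℕ} (r : Fin n → Fin k) (z : Fin k) : Option (Fin n) :=
  Fin.find? fun j => decide (IsCyclicNeighbor z (r j))

lemma firstNeighbor_eq_some {k n : ℕ} {r : Fin n → Fin k} {z : Fin k} {j : Fin n} :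
    firstNeighbor r z = some j ↔
      IsCyclicNeighbor z (r j) ∧ ∀ m, m < j → ¬ IsCyclicNeighbor z (r m) := by
  classical
  simp [firstNeighbor]

lemma firstNeighbor_eq_none {k n : ℕ} {r : Fin n → Fin k} {z : Fin k} :
    firstNeighbor r z = none ↔ ∀ m, ¬ IsCyclicNeighbor z (r m) := by
  classical
  simp [firstNeighbor]

/-- The upper bound for a coordinate whose first neighbour in the tuple is `o`, given the values
`y` of the coordinates in the tuple. -/
def coordBound {n : ℕ} (y : Fin n → ℝ) (o : Option (Fin n)) : ℝ :=
  o.elim 1 fun j => 1 / y j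

/-- A position in a tuple of pairwise nonconsecutive indices is a neighbour of none of them. -/
lemma notMem_range_of_isCyclicNeighbor {k n : ℕ} {r : Fin n → Fin k} (hn : n ≤ k / 2)
    (hr : r ∈ nonconsecTuples k n) {z : Fin k} {j : Fin n} (h : IsCyclicNeighbor z (r j)) :
    z ∉ Set.range r := by
  rintro ⟨i, rfl⟩
  by_cases hij : i = j
  · subst hij
    have := i.2
    exact not_isCyclicNeighbor_self (by omega) _ h
  · exact (mem_nonconsecTuples.1 hr i j hij).2 h

/-- On a region the constraints of the polytope decouple: each coordinate outside of the tuple has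
a single upper bound that depends on the coordinates in the tuple only. -/
lemma mem_sortedRegion_iff {k n : ℕ} {r : Fin n → Fin k} (hn : n ≤ k / 2)
    (hr : r ∈ nonconsecTuples k n) {x : Fin k → ℝ} (hpos : ∀ i, 0 < x i) :
    x ∈ sortedRegion r ↔ (∀ j, 1 ≤ x (r j)) ∧ StrictAnti (x ∘ r) ∧
      ∀ z, z ∉ Set.range r → x z < coordBound (x ∘ r) (firstNeighbor r z) := by
  constructor
  · rintro ⟨-, hpoly, hge, hanti, hlt⟩
    refine ⟨hge, hanti, fun z hz => ?_⟩
    rcases h : firstNeighbor r z with _ | j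
    · exact hlt z hz
    · have hj := (firstNeighbor_eq_some.1 h).1
      simp only [coordBound, Option.elim, Function.comp_apply]
      rw [lt_div_iff₀ (hpos _)]
      rcases hj with rfl | hj
      · rw [mul_comm]
        exact hpoly _
      · rw [← hj]
        exact hpoly _
  · rintro ⟨hge, hanti, hb⟩
    have hlt : ∀ z, z ∉ Set.range r → x z < 1 := fun z hz => by
      refine (hb z hz).trans_le ?_
      rcases firstNeighbor r z with _ | j
      · exact le_rfl
      · simp only [coordBound, Option.elim, Function.comp_apply]
        rw [div_le_one (hpos _)]
        exact hge j
    have hnb : ∀ z j, IsCyclicNeighbor z (r j) → x z * x (r j) < 1 := fun z j h => by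
      have h1 := hb z (notMem_range_of_isCyclicNeighbor hn hr h)
      rcases ho : firstNeighbor r z with _ | m
      · exact absurd h (firstNeighbor_eq_none.1 ho j)
      · rw [ho] at h1
        simp only [coordBound, Option.elim, Function.comp_apply] at h1
        have hmj : m ≤ j := by
          by_contra! hlt'
          exact (firstNeighbor_eq_some.1 ho).2 j hlt' h
        rw [lt_div_iff₀ (hpos _)] at h1
        exact (mul_le_mul_of_nonneg_left (hanti.antitone hmj) (hpos z).le).trans_lt h1
    refine ⟨hpos, fun i => ?_, hge, hanti, hlt⟩
    by_cases hi : i ∈ Set.range r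
    · obtain ⟨j, rfl⟩ := hi
      rw [mul_comm]
      exact hnb _ j (Or.inl rfl)
    · by_cases hi' : finRotate k i ∈ Set.range r
      · obtain ⟨j, hj⟩ := hi'
        rw [← hj]
        exact hnb _ j (Or.inr hj.symm)
      · exact mul_lt_one_of_nonneg_of_lt_one_left (hpos i).le (hlt i hi) (hlt _ hi').le

/-- The positions outside of the tuple, counted by their first neighbour in it. -/
lemma prod_coordBound_firstNeighbor {k n : ℕ} {r : Fin n → Fin k} (hn : n ≤ k / 2)
    (hr : r ∈ nonconsecTuples k n) {M : Type*} [CommMonoid M] (g : Option (Fin n) → M)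
    [Fintype {z // z ∉ Set.range r}] :
    ∏ z : {z // z ∉ Set.range r}, g (firstNeighbor r z) =
      g none ^ (k - n - ∑ j, alpha r j) * ∏ j, g (some j) ^ alpha r j := by
  classical
  have hinj : Function.Injective r := fun i j h => by
    by_contra hij
    exact (mem_nonconsecTuples.1 hr i j hij).1 h
  have hα : ∀ j, Finset.card {z : {z // z ∉ Set.range r} | firstNeighbor r z = some j} =
      alpha r j := fun j => by
    rw [alpha]
    refine Finset.card_bij (fun z _ => z.1) (fun z hz => ?_) (fun z _ z' _ h => Subtype.ext h)
      fun z hz => ?_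
    · simpa [firstNeighbor_eq_some] using hz
    · simp only [Finset.mem_filter, Finset.mem_univ, true_and] at hz
      exact ⟨⟨z, notMem_range_of_isCyclicNeighbor hn hr hz.1⟩,
        by simpa [firstNeighbor_eq_some] using hz, rfl⟩
  have hcard : Fintype.card {z // z ∉ Set.range r} = k - n := by
    rw [Fintype.card_subtype_compl, Fintype.card_fin]
    congr 1
    exact (Set.card_range_of_injective hinj).trans (Fintype.card_fin n)
  have hsum : ∑ o : Option (Fin n),
      Finset.card {z : {z // z ∉ Set.range r} | firstNeighbor r z = o} = k - n := by
    rw [← hcard, ← Finset.card_univ]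
    exact (Finset.card_eq_sum_card_fiberwise fun z _ => Finset.mem_coe.2 (Finset.mem_univ _)).symm
  rw [Fintype.sum_option] at hsum
  simp_rw [hα] at hsum
  have hnone : Finset.card {z : {z // z ∉ Set.range r} | firstNeighbor r z = none} =
      k - n - ∑ j, alpha r j := by omega
  rw [← Finset.prod_fiberwise Finset.univ (fun z : {z // z ∉ Set.range r} => firstNeighbor r z),
    Fintype.prod_option, ← hnone]
  have hconst : ∀ o : Option (Fin n),
      ∏ z ∈ Finset.univ.filter (fun z : {z // z ∉ Set.range r} => firstNeighbor r z = o),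
          g (firstNeighbor r z) =
        g o ^ Finset.card {z : {z // z ∉ Set.range r} | firstNeighbor r z = o} := fun o => by
    rw [Finset.prod_congr rfl (g := fun _ => g o), Finset.prod_const]
    intro z hz
    rw [(Finset.mem_filter.1 hz).2]
  simp_rw [hconst, hα]

/-! ### The measure of a region -/

/-- Independent variables may be split into two independent families. -/
lemma pi_apply_eq_prod {ι κ τ : Type*} [Fintype ι] [Fintype κ] [Fintype τ] (ν : Measure ℝ)
    [SigmaFinite ν] (e : ι ⊕ κ ≃ τ) (S : Set (τ → ℝ)) :
    (Measure.pi fun _ : τ => ν) S =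
      ((Measure.pi fun _ : ι => ν).prod (Measure.pi fun _ : κ => ν))
        {p | (fun t => Sum.elim p.1 p.2 (e.symm t)) ∈ S} := by
  have h1 := measurePreserving_sumPiEquivProdPi_symm (X := fun _ : ι ⊕ κ => ℝ) fun _ => ν
  have h2 := measurePreserving_piCongrLeft (α := fun _ : τ => ℝ) (fun _ => ν) e
  have h3 := (h2.comp h1).measure_preimage_emb
    (((MeasurableEquiv.sumPiEquivProdPi fun _ : ι ⊕ κ => ℝ).symm.trans
      (MeasurableEquiv.piCongrLeft (fun _ : τ => ℝ) e)).measurableEmbedding) S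
  rw [← h3]
  congr 1
  ext p
  simp only [Set.mem_preimage, Set.mem_ofPred_eq]
  have : (MeasurableEquiv.piCongrLeft (fun _ : τ => ℝ) e ∘
      (MeasurableEquiv.sumPiEquivProdPi fun _ : ι ⊕ κ => ℝ).symm) p =
        fun t => Sum.elim p.1 p.2 (e.symm t) := by
    funext t
    obtain ⟨s, rfl⟩ := e.surjective t
    rw [Equiv.symm_apply_apply]
    refine (Equiv.piCongrLeft_apply_apply (fun _ : τ => ℝ) e _ s).trans ?_
    rcases s with i | j <;> rfl
  rw [this]

lemma cdfOf_eq_toReal {f : ℝ → ℝ} (h0 : ∀ x, 0 < x → 0 ≤ f x)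
    (hf : IntegrableOn f (Set.Ioi 0)) : ∀ t, 0 ≤ t → cdfOf f t = (lawOf f (Set.Iio t)).toReal := fun t ht => by
  rw [lawOf_Iio h0 hf ht, ENNReal.toReal_ofReal (cdfOf_nonneg h0 ht)]

lemma measurable_lawOf_Iio (f : ℝ → ℝ) : Measurable fun t => lawOf f (Set.Iio t) :=
  Monotone.measurable fun _ _ h => measure_mono (Set.Iio_subset_Iio h)

lemma measurableSet_antitone_one_le (n : ℕ) :
    MeasurableSet {x : Fin n → ℝ | (∀ j, 1 ≤ x j) ∧ Antitone x} := by
  have h1 : MeasurableSet {x : Fin n → ℝ | ∀ j, 1 ≤ x j} := by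
    simp only [Set.ofPred_forall]
    exact .iInter fun i => measurableSet_le measurable_const (measurable_pi_apply _)
  have h2 : MeasurableSet {x : Fin n → ℝ | Antitone x} := by
    have : {x : Fin n → ℝ | Antitone x} =
        ⋂ (i : Fin n) (j : Fin n) (_ : i ≤ j), {x | x j ≤ x i} := by
      ext x
      simp only [Set.mem_ofPred_eq, Set.mem_iInter]
      exact ⟨fun h i j hij => h hij, fun h i j hij => h i j hij⟩
    rw [this]
    exact MeasurableSet.iInter fun i => .iInter fun j => .iInter fun _ =>
      measurableSet_le (measurable_pi_apply _) (measurable_pi_apply _)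
  exact h1.inter h2

/-- The measure of a region as an integral over the coordinates in the tuple: the other
coordinates are independent of each other and each contributes the mass below its bound. -/
lemma pi_lawOf_sortedRegion {k n : ℕ} {r : Fin n → Fin k} (hn : n ≤ k / 2)
    (hr : r ∈ nonconsecTuples k n) {f : ℝ → ℝ} (hf : IntegrableOn f (Set.Ioi 0)) :
    (Measure.pi fun _ : Fin k => lawOf f) (sortedRegion r) =
      ∫⁻ y in {x : Fin n → ℝ | (∀ j, 1 ≤ x j) ∧ Antitone x},
        lawOf f (Set.Iio 1) ^ (k - n - ∑ j, alpha r j) *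
          ∏ j, lawOf f (Set.Iio (1 / y j)) ^ alpha r j
        ∂(Measure.pi fun _ : Fin n => lawOf f) := by
  classical
  have hfin := isFiniteMeasure_lawOf hf
  have hinj : Function.Injective r := fun i j h => by
    by_contra hij
    exact (mem_nonconsecTuples.1 hr i j hij).1 h
  set e : Fin n ⊕ {z // z ∉ Set.range r} ≃ Fin k :=
    ((Equiv.ofInjective r hinj).sumCongr (Equiv.refl _)).trans
      (Equiv.sumCompl (· ∈ Set.range r)) with he
  have hel : ∀ j, e.symm (r j) = Sum.inl j := fun j => by
    rw [Equiv.symm_apply_eq]; rfl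
  have her : ∀ z : {z // z ∉ Set.range r}, e.symm z = Sum.inr z := fun z => by
    rw [Equiv.symm_apply_eq]; rfl
  have hmeas : MeasurableSet {p : (Fin n → ℝ) × ({z // z ∉ Set.range r} → ℝ) |
      (fun t => Sum.elim p.1 p.2 (e.symm t)) ∈ sortedRegion r} := by
    refine (measurableSet_sortedRegion r).preimage (measurable_pi_lambda _ fun t => ?_)
    rcases e.symm t with i | j
    · exact (measurable_pi_apply i).comp measurable_fst
    · exact (measurable_pi_apply j).comp measurable_snd
  rw [pi_apply_eq_prod _ e, Measure.prod_apply hmeas,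
    ← lintegral_indicator (measurableSet_antitone_one_le n)]
  refine lintegral_congr_ae ?_
  filter_upwards [ae_pos_pi_lawOf (ι := Fin n) hf, ae_injective_pi_lawOf (ι := Fin n) hf]
    with y hypos hyinj
  have hcong : (Measure.pi fun _ : {z // z ∉ Set.range r} => lawOf f)
      (Prod.mk y ⁻¹' {p : (Fin n → ℝ) × ({z // z ∉ Set.range r} → ℝ) |
        (fun t => Sum.elim p.1 p.2 (e.symm t)) ∈ sortedRegion r}) =
      (Measure.pi fun _ : {z // z ∉ Set.range r} => lawOf f)
        {w | ((∀ j, 1 ≤ y j) ∧ Antitone y) ∧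
          ∀ z, w z < coordBound y (firstNeighbor r z)} := by
    refine measure_congr ?_
    filter_upwards [ae_pos_pi_lawOf (ι := {z // z ∉ Set.range r}) hf] with w hwpos
    refine propext ?_
    have hpos : ∀ t, 0 < Sum.elim y w (e.symm t) := fun t => by
      rcases e.symm t with i | j
      · exact hypos i
      · exact hwpos j
    have hcomp : (fun t => Sum.elim y w (e.symm t)) ∘ r = y := by
      funext j
      simp [hel]
    refine (mem_sortedRegion_iff hn hr hpos).trans ?_
    rw [hcomp]
    simp only [hel, Sum.elim_inl]
    constructor
    · rintro ⟨h1, h2, h3⟩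
      refine ⟨⟨h1, h2.antitone⟩, fun z => ?_⟩
      have := h3 z z.2
      rwa [her] at this
    · rintro ⟨⟨h1, h2⟩, h3⟩
      refine ⟨h1, h2.strictAnti_of_injective hyinj, fun z hz => ?_⟩
      have := h3 ⟨z, hz⟩
      rwa [her ⟨z, hz⟩]
  rw [hcong]
  by_cases hy : (∀ j, 1 ≤ y j) ∧ Antitone y
  · rw [Set.indicator_of_mem (by exact hy)]
    have hset : {w : {z // z ∉ Set.range r} → ℝ | ((∀ j, 1 ≤ y j) ∧ Antitone y) ∧
        ∀ z, w z < coordBound y (firstNeighbor r z)} =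
        Set.univ.pi fun z : {z // z ∉ Set.range r} =>
          Set.Iio (coordBound y (firstNeighbor r z)) := by
      ext w
      simp [hy]
    rw [hset, Measure.pi_pi, prod_coordBound_firstNeighbor hn hr
      (fun o => lawOf f (Set.Iio (coordBound y o)))]
    rfl
  · rw [Set.indicator_of_notMem (by exact hy)]
    simp [hy]

lemma measureReal_sortedRegion {k n : ℕ} {r : Fin n → Fin k} (hn : n ≤ k / 2)
    (hr : r ∈ nonconsecTuples k n) {f : ℝ → ℝ} (hm : Measurable f)
    (h0 : ∀ x, 0 < x → 0 ≤ f x) (hf : IntegrableOn f (Set.Ioi 0)) :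
    (Measure.pi fun _ : Fin k => lawOf f).real (sortedRegion r) = tupleIntegral f r := by
  have hcdf := cdfOf_eq_toReal h0 hf
  have hD := measurableSet_antitone_one_le n
  have hprod : Measurable fun y : Fin n → ℝ => ∏ j, lawOf f (Set.Iio (1 / y j)) ^ alpha r j :=
    Finset.measurable_prod _ fun j _ => ((measurable_lawOf_Iio f).comp
      (measurable_const.div (measurable_pi_apply j))).pow_const _
  have hdens : Measurable fun y : Fin n → ℝ => ∏ j, ENNReal.ofReal (f (y j)) :=
    Finset.measurable_prod _ fun j _ => (hm.comp (measurable_pi_apply j)).ennreal_ofReal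
  rw [Measure.real, pi_lawOf_sortedRegion hn hr hf, lintegral_const_mul _ hprod,
    ENNReal.toReal_mul, ENNReal.toReal_pow, ← hcdf 1 zero_le_one, tupleIntegral]
  congr 1
  have hsub : {x : Fin n → ℝ | (∀ j, 1 ≤ x j) ∧ Antitone x} ⊆
      Set.univ.pi fun _ : Fin n => Set.Ioi (0 : ℝ) := fun x hx i _ =>
    zero_lt_one.trans_le (hx.1 i)
  rw [pi_lawOf hf, restrict_withDensity hD, Measure.restrict_restrict hD,
    Set.inter_eq_left.2 hsub, lintegral_withDensity_eq_lintegral_mul _ hdens hprod]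
  have hae : ∀ᵐ y ∂(volume.restrict {x : Fin n → ℝ | (∀ j, 1 ≤ x j) ∧ Antitone x}),
      ∏ j, f (y j) * cdfOf f (1 / y j) ^ alpha r j =
        (((fun y : Fin n → ℝ => ∏ j, ENNReal.ofReal (f (y j))) *
          fun y : Fin n → ℝ => ∏ j, lawOf f (Set.Iio (1 / y j)) ^ alpha r j) y).toReal := by
    filter_upwards [ae_restrict_mem hD] with y hy
    rw [Pi.mul_apply, ENNReal.toReal_mul, ENNReal.toReal_prod, ENNReal.toReal_prod,
      ← Finset.prod_mul_distrib]
    refine Finset.prod_congr rfl fun j _ => ?_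
    have hj := zero_lt_one.trans_le (hy.1 j)
    rw [ENNReal.toReal_ofReal (h0 _ hj), ENNReal.toReal_pow, hcdf _ (by positivity)]
  rw [integral_congr_ae hae, integral_toReal (hdens.mul hprod).aemeasurable]
  have hfin := isFiniteMeasure_lawOf hf
  refine Eventually.of_forall fun y => ENNReal.mul_lt_top ?_ ?_
  · exact ENNReal.prod_lt_top fun j _ => ENNReal.ofReal_lt_top
  · exact ENNReal.prod_lt_top fun j _ => ENNReal.pow_lt_top (measure_lt_top _ _)

/-- The polytope is, up to a null set, the disjoint union of the regions of all tuples. -/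
lemma probPolytope_eq_sum (k : ℕ) {f : ℝ → ℝ} (hm : Measurable f)
    (h0 : ∀ x, 0 < x → 0 ≤ f x) (hf : IntegrableOn f (Set.Ioi 0)) :
    probPolytope k f = cdfOf f 1 ^ k +
      ∑ n ∈ Finset.Icc 1 (k / 2), ∑ r ∈ nonconsecTuples k n, tupleIntegral f r := by
  classical
  have hfin := isFiniteMeasure_lawOf hf
  set P := Measure.pi fun _ : Fin k => lawOf f with hP
  have hunion : P.real {x | ∀ i, x i * x (finRotate k i) < 1} =
      P.real (⋃ p : (n : Fin (k / 2 + 1)) × (Fin n → Fin k), sortedRegion p.2) := by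
    refine measureReal_congr ?_
    filter_upwards [ae_pos_pi_lawOf (ι := Fin k) hf, ae_injective_pi_lawOf (ι := Fin k) hf]
      with x hpos hinj
    refine propext ?_
    change (∀ i, x i * x (finRotate k i) < 1) ↔
      x ∈ ⋃ p : (n : Fin (k / 2 + 1)) × (Fin n → Fin k), sortedRegion p.2
    rw [Set.mem_iUnion]
    constructor
    · intro h
      obtain ⟨n, hn, r, hr⟩ := exists_mem_sortedRegion hpos hinj h
      exact ⟨⟨⟨n, by omega⟩, r⟩, hr⟩
    · rintro ⟨p, hp⟩
      exact hp.2.1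
  have hdisj : Pairwise (Function.onFun Disjoint
      fun p : (n : Fin (k / 2 + 1)) × (Fin n → Fin k) => sortedRegion p.2) := by
    rintro ⟨⟨n, hn⟩, r⟩ ⟨⟨n', hn'⟩, r'⟩ hne
    refine Set.disjoint_left.2 fun x hx hx' => hne ?_
    obtain ⟨h, h'⟩ := sigma_eq_of_mem_sortedRegion (r := r) (r' := r') hx hx'
    change n = n' at h
    subst h
    subst h'
    rfl
  rw [probPolytope, hunion, measureReal_iUnion_fintype hdisj
    fun p => measurableSet_sortedRegion p.2, Fintype.sum_sigma]
  have hinner : ∀ n : Fin (k / 2 + 1), ∑ r : Fin n → Fin k, P.real (sortedRegion r) =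
      ∑ r ∈ nonconsecTuples k n, tupleIntegral f r := fun n => by
    rw [← Finset.sum_subset (Finset.subset_univ (nonconsecTuples k n))]
    · exact Finset.sum_congr rfl fun r hr =>
        measureReal_sortedRegion (by have := n.2; omega) hr hm h0 hf
    · intro r _ hr
      rw [Set.eq_empty_of_forall_notMem fun x hx =>
        hr (mem_nonconsecTuples_of_mem_sortedRegion hx)]
      simp
  rw [Finset.sum_congr rfl fun n _ => hinner n,
    Fin.sum_univ_eq_sum_range
      (fun n => ∑ r ∈ nonconsecTuples k n, tupleIntegral f r) (k / 2 + 1),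
    Finset.range_eq_Ico, Finset.sum_eq_sum_Ico_succ_bot (Nat.succ_pos _)]
  -- The empty tuple gives the first summand.
  congr 1
  have huniv : nonconsecTuples k 0 = Finset.univ := by
    ext r
    exact iff_of_true (mem_nonconsecTuples.2 fun i => i.elim0) (Finset.mem_univ _)
  rw [huniv, Fintype.sum_unique, tupleIntegral]
  have hset : {x : Fin 0 → ℝ | (∀ j, 1 ≤ x j) ∧ Antitone x} = Set.univ := by
    ext x
    simp [Subsingleton.antitone]
  rw [hset]
  have hvol : (volume : Measure (Fin 0 → ℝ)) Set.univ = 1 := Measure.pi_empty_univ _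
  simp [Measure.real, hvol]

/-! ### Cyclic determinants and cyclic linear systems -/

lemma det_diagonal_add_cyclic_succ {m : ℕ} (p q : Fin (m + 1) → ℝ) :
    (Matrix.of fun i j => (if j = i then p i else 0) + (if j = i + 1 then q i else 0)).det =
      ∏ i, p i - (-1) ^ (m + 1) * ∏ i, q i := by
  set A : Matrix (Fin (m + 1)) (Fin (m + 1)) ℝ :=
    Matrix.of fun i j => (if j = i then p i else 0) + (if j = i + 1 then q i else 0) with hA
  have hval : ∀ i : Fin (m + 1), ((i + 1 : Fin (m + 1)) : ℕ) =
      if (i : ℕ) = m then 0 else (i : ℕ) + 1 := fun i => by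
    rw [Fin.val_add_one]; simp [Fin.ext_iff]
  have hcol : ∀ i, A i 0 = (if i = 0 then p 0 else 0) +
      (if i = Fin.last m then q (Fin.last m) else 0) := fun i => by
    have h1 : (0 = i + 1) ↔ i = Fin.last m := by
      have := i.2
      have e := hval i
      rw [Fin.ext_iff, Fin.ext_iff, Fin.val_last, Fin.val_zero]
      split_ifs at e <;> omega
    simp only [hA, Matrix.of_apply, h1]
    congr 1
    · by_cases h : i = 0
      · simp [h]
      · simp [h, Ne.symm h]
    · by_cases h : i = Fin.last m <;> simp [h]
  have hup : (A.submatrix (Fin.succAbove 0) Fin.succ).det = ∏ i : Fin m, p i.succ := by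
    rw [Matrix.det_of_isUpperTriangular]
    · refine Finset.prod_congr rfl fun i _ => ?_
      have h1 : ¬ (i.succ = i.succ + 1) := by
        have := i.2
        have e := hval i.succ
        rw [Fin.ext_iff]
        simp only [Fin.val_succ] at e ⊢
        split_ifs at e <;> omega
      simp [hA, h1]
    · intro i j hij
      simp only [id_eq, Fin.lt_def] at hij
      have h1 : ¬ (j.succ = i.succ + 1) := by
        have := i.2
        have e := hval i.succ
        rw [Fin.ext_iff]
        simp only [Fin.val_succ] at e ⊢
        split_ifs at e <;> omega
      have h2 : ¬ (j = i) := by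
        simp only [Fin.ext_iff]; omega
      simp [hA, h1, h2]
  have hlow : (A.submatrix (Fin.succAbove (Fin.last m)) Fin.succ).det =
      ∏ i : Fin m, q i.castSucc := by
    rw [Matrix.det_of_isLowerTriangular]
    · refine Finset.prod_congr rfl fun i _ => ?_
      have h1 : ¬ (i.succ = i.castSucc) := by
        simp [Fin.ext_iff]
      have h2 : i.succ = i.castSucc + 1 := by
        have := i.2
        simp only [Fin.ext_iff, hval, Fin.val_succ, Fin.val_castSucc]
        split_ifs <;> omega
      simp only [hA, Matrix.submatrix_apply, Fin.succAbove_last, Matrix.of_apply, if_neg h1,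
        if_pos h2, zero_add]
    · intro i j hij
      have hij' : (i : ℕ) < j := by simpa using hij
      have h1 : ¬ (j.succ = i.castSucc) := by
        simp only [Fin.ext_iff, Fin.val_succ, Fin.val_castSucc]; omega
      have h2 : ¬ (j.succ = i.castSucc + 1) := by
        have := i.2
        simp only [Fin.ext_iff, hval, Fin.val_succ, Fin.val_castSucc]
        split_ifs <;> omega
      simp only [hA, Matrix.submatrix_apply, Fin.succAbove_last, Matrix.of_apply, if_neg h1,
        if_neg h2, zero_add]
  -- The first column has at most two nonzero entries, with triangular minors.
  rw [Matrix.det_succ_column_zero]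
  simp_rw [hcol, mul_add, add_mul]
  rw [Finset.sum_add_distrib, Finset.sum_eq_single 0, Finset.sum_eq_single (Fin.last m)]
  · rw [if_pos rfl, if_pos rfl, hup, hlow, Fin.prod_univ_succ p, Fin.prod_univ_castSucc q]
    simp only [Fin.val_zero, Fin.val_last, pow_succ]
    ring
  · intro i _ hi
    simp [hi]
  · simp
  · intro i _ hi
    simp [hi]
  · simp

/-- The determinant of a diagonal matrix plus a weighted cyclic permutation matrix; for
`k = 1` both weights contribute to the single entry. -/
lemma det_diagonal_add_finRotate {k : ℕ} (hk : 1 ≤ k) (p q : Fin k → ℝ) :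
    (Matrix.of fun i j =>
      (if j = i then p i else 0) + (if j = finRotate k i then q i else 0)).det =
      ∏ i, p i - (-1) ^ k * ∏ i, q i := by
  obtain ⟨m, rfl⟩ : ∃ m, k = m + 1 := ⟨k - 1, by omega⟩
  simp_rw [finRotate_apply]
  exact det_diagonal_add_cyclic_succ p q

/-- A cyclic linear system with coefficients less than `1` has only the trivial solution: look at
an entry of largest absolute value. -/
lemma eq_zero_of_add_mul_comp_eq_zero {k : ℕ} (σ : Fin k → Fin k) {y d : Fin k → ℝ}
    (hy : ∀ i, y i ∈ Set.Ioo (0 : ℝ) 1) (hd : ∀ i, d i + y i * d (σ i) = 0) : d = 0 := by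
  funext i₀
  obtain ⟨i, -, hi⟩ := Finset.exists_max_image Finset.univ (fun i => |d i|) ⟨i₀, Finset.mem_univ _⟩
  have h1 : |d i| = y i * |d (σ i)| := by
    rw [eq_neg_of_add_eq_zero_left (hd i), abs_neg, abs_mul, abs_of_pos (hy i).1]
  have h2 := hi (σ i) (Finset.mem_univ _)
  have h3 := hi i₀ (Finset.mem_univ _)
  have h4 : |d i| = 0 := by
    nlinarith [abs_nonneg (d i), (hy i).1, (hy i).2, abs_nonneg (d (σ i))]
  exact abs_eq_zero.1 (le_antisymm (h3.trans h4.le) (abs_nonneg _))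

/-- The cyclic system `u i = y i * (1 - u (σ i))` has a solution, and the distance of its entries
from `1 / 2` shows that they lie in the unit interval. -/
lemma exists_mem_Ioo_eq_mul_one_sub {k : ℕ} (σ : Fin k → Fin k) {y : Fin k → ℝ}
    (hy : ∀ i, y i ∈ Set.Ioo (0 : ℝ) 1) :
    ∃ u : Fin k → ℝ, (∀ i, u i ∈ Set.Ioo (0 : ℝ) 1) ∧ ∀ i, u i = y i * (1 - u (σ i)) := by
  let L : (Fin k → ℝ) →ₗ[ℝ] (Fin k → ℝ) :=
    { toFun := fun u i => u i + y i * u (σ i)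
      map_add' := fun u v => by funext i; simp only [Pi.add_apply]; ring
      map_smul' := fun c u => by
        funext i; simp only [Pi.smul_apply, smul_eq_mul, RingHom.id_apply]; ring }
  have hinj : Function.Injective L := by
    rw [injective_iff_map_eq_zero]
    exact fun d hd => eq_zero_of_add_mul_comp_eq_zero σ hy fun i => congrFun hd i
  obtain ⟨u, hu⟩ := LinearMap.injective_iff_surjective.1 hinj y
  have hu' : ∀ i, u i + y i * u (σ i) = y i := fun i => congrFun hu i
  have hhalf : ∀ j, |u j - 1 / 2| ≤ 1 / 2 := fun j => by
    obtain ⟨i, -, hi⟩ := Finset.exists_max_image Finset.univ (fun i => |u i - 1 / 2|)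
      ⟨j, Finset.mem_univ _⟩
    refine (hi j (Finset.mem_univ _)).trans ?_
    have h1 := hi (σ i) (Finset.mem_univ _)
    have h2 : u i - 1 / 2 = -((1 - y i) / 2 + y i * (u (σ i) - 1 / 2)) := by
      linear_combination hu' i
    have h3 : |u i - 1 / 2| ≤ (1 - y i) / 2 + y i * |u (σ i) - 1 / 2| := by
      rw [h2, abs_neg]
      refine (abs_add_le _ _).trans ?_
      rw [abs_mul, abs_of_pos (hy i).1, abs_of_nonneg (by linarith [(hy i).2])]
    have h4 := mul_le_mul_of_nonneg_left h1 (hy i).1.le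
    by_contra! h5
    nlinarith [(hy i).2, (hy i).1]
  have hle : ∀ j, 0 ≤ u j ∧ u j ≤ 1 := fun j => by
    have := abs_le.1 (hhalf j)
    constructor <;> linarith [this.1, this.2]
  have hlt : ∀ j, u j < 1 := fun j => by
    nlinarith [hu' j, (hy j).1, (hy j).2, (hle (σ j)).1]
  refine ⟨u, fun j => ⟨?_, hlt j⟩, fun j => by linarith [hu' j]⟩
  nlinarith [hu' j, (hy j).1, hlt (σ j), mul_pos (hy j).1 (sub_pos.2 (hlt (σ j)))]

/-! ### The substitution from the polytope to the cube -/

/-- The factor `(1 + t ^ a) ^ (1 / a)`. -/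
def rootFactor (a : ℕ) (t : ℝ) : ℝ := (1 + t ^ a) ^ (1 / a : ℝ)

lemma rootFactor_pos {a : ℕ} {t : ℝ} (ht : 0 < t) : 0 < rootFactor a t :=
  Real.rpow_pos_of_pos (by positivity) _

lemma rootFactor_pow {a : ℕ} (ha : a ≠ 0) {t : ℝ} (ht : 0 < t) :
    rootFactor a t ^ a = 1 + t ^ a := by
  rw [rootFactor, ← Real.rpow_natCast, ← Real.rpow_mul (by positivity),
    one_div_mul_cancel (by exact_mod_cast ha), Real.rpow_one]

lemma hasDerivAt_rootFactor {a : ℕ} (ha : a ≠ 0) {t : ℝ} (ht : 0 < t) :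
    HasDerivAt (rootFactor a) (t ^ (a - 1) * rootFactor a t / (1 + t ^ a)) t := by
  have h1 : HasDerivAt (fun s : ℝ => 1 + s ^ a) (a * t ^ (a - 1)) t :=
    (hasDerivAt_pow a t).const_add 1
  have hpos : (0 : ℝ) < 1 + t ^ a := by positivity
  have ha' : (a : ℝ) ≠ 0 := by exact_mod_cast ha
  refine (h1.rpow_const (p := 1 / a) (Or.inl hpos.ne')).congr_deriv ?_
  rw [Real.rpow_sub_one hpos.ne', rootFactor]
  field_simp

lemma hasDerivAt_div_rootFactor {a : ℕ} (ha : a ≠ 0) {t : ℝ} (ht : 0 < t) :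
    HasDerivAt (fun s => s / rootFactor a s) (1 / (rootFactor a t * (1 + t ^ a))) t := by
  have hw := rootFactor_pos (a := a) ht
  refine ((hasDerivAt_id t).div (hasDerivAt_rootFactor ha ht) hw.ne').congr_deriv ?_
  have hpos : (0 : ℝ) < 1 + t ^ a := by positivity
  obtain ⟨b, rfl⟩ : ∃ b, a = b + 1 := ⟨a - 1, by omega⟩
  simp only [id, Nat.add_sub_cancel]
  field_simp
  ring

/-- The open polytope `x i * x (i + 1) < 1` in the positive orthant. -/
def openPolytope (k : ℕ) : Set (Fin k → ℝ) :=
  {x | (∀ i, 0 < x i) ∧ ∀ i, x i * x (finRotate k i) < 1}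

/-- The substitution that carries the polytope to the unit cube; the `a`-th power of its `i`-th
coordinate is `ξ i ^ a * (1 + ξ (i + 1) ^ a) / (1 + ξ i ^ a)`. -/
def toCube (k a : ℕ) (ξ : Fin k → ℝ) (i : Fin k) : ℝ :=
  ξ i / rootFactor a (ξ i) * rootFactor a (ξ (finRotate k i))

/-- The Jacobian matrix of `toCube`. -/
def toCubeJacobian (k a : ℕ) (ξ : Fin k → ℝ) : Matrix (Fin k) (Fin k) ℝ :=
  Matrix.of fun i j =>
    (if j = i then 1 / (rootFactor a (ξ i) * (1 + ξ i ^ a)) * rootFactor a (ξ (finRotate k i))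
      else 0) +
    (if j = finRotate k i then ξ i / rootFactor a (ξ i) *
      (ξ (finRotate k i) ^ (a - 1) * rootFactor a (ξ (finRotate k i)) /
        (1 + ξ (finRotate k i) ^ a)) else 0)

lemma hasFDerivAt_toCube {k a : ℕ} (ha : a ≠ 0) {ξ : Fin k → ℝ} (hξ : ∀ i, 0 < ξ i) :
    HasFDerivAt (toCube k a)
      (LinearMap.toContinuousLinearMap (Matrix.toLin' (toCubeJacobian k a ξ))) ξ := by
  rw [hasFDerivAt_pi']
  intro i
  have hp : ∀ j, HasFDerivAt (fun x : Fin k → ℝ => x j) (ContinuousLinearMap.proj j) ξ :=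
    fun j => hasFDerivAt_apply (𝕜 := ℝ) (F' := fun _ : Fin k => ℝ) j ξ
  have h1 := HasDerivAt.comp_hasFDerivAt (f := fun x : Fin k → ℝ => x i) ξ
    (hasDerivAt_div_rootFactor ha (hξ i)) (hp i)
  have h2 := HasDerivAt.comp_hasFDerivAt (f := fun x : Fin k → ℝ => x (finRotate k i)) ξ
    (hasDerivAt_rootFactor ha (hξ (finRotate k i))) (hp (finRotate k i))
  refine (h1.mul h2).congr_fderiv ?_
  ext v
  simp only [toCubeJacobian, add_apply, smul_apply, Function.comp_apply,
    ContinuousLinearMap.proj_apply, smul_eq_mul, ContinuousLinearMap.comp_apply,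
    LinearMap.coe_toContinuousLinearMap', Matrix.toLin'_apply, Matrix.mulVec, dotProduct,
    Matrix.of_apply, add_mul, Finset.sum_add_distrib, ite_mul, zero_mul, Finset.sum_ite_eq',
    Finset.mem_univ, if_true]
  ring

lemma det_toCubeJacobian {k a : ℕ} (hk : 1 ≤ k) (ha : a ≠ 0) {ξ : Fin k → ℝ}
    (hξ : ∀ i, 0 < ξ i) :
    (toCubeJacobian k a ξ).det =
      (∏ i, 1 / (1 + ξ i ^ a)) * (1 - (-1) ^ k * ∏ i, ξ i ^ a) := by
  have hw : ∏ i, rootFactor a (ξ i) ≠ 0 :=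
    Finset.prod_ne_zero_iff.2 fun i _ => (rootFactor_pos (hξ i)).ne'
  rw [toCubeJacobian, det_diagonal_add_finRotate hk]
  have e1 : ∏ i, 1 / (rootFactor a (ξ i) * (1 + ξ i ^ a)) * rootFactor a (ξ (finRotate k i)) =
      ∏ i, 1 / (1 + ξ i ^ a) := by
    rw [Finset.prod_mul_distrib,
      Equiv.prod_comp (finRotate k) (fun i => rootFactor a (ξ i)), ← Finset.prod_mul_distrib]
    refine Finset.prod_congr rfl fun i _ => ?_
    have := rootFactor_pos (a := a) (hξ i)
    field_simp
  have e2 : ∏ i, ξ i / rootFactor a (ξ i) *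
      (ξ (finRotate k i) ^ (a - 1) * rootFactor a (ξ (finRotate k i)) /
        (1 + ξ (finRotate k i) ^ a)) =
      (∏ i, 1 / (1 + ξ i ^ a)) * ∏ i, ξ i ^ a := by
    rw [Finset.prod_mul_distrib,
      Equiv.prod_comp (finRotate k)
        (fun i => ξ i ^ (a - 1) * rootFactor a (ξ i) / (1 + ξ i ^ a)),
      ← Finset.prod_mul_distrib, ← Finset.prod_mul_distrib]
    refine Finset.prod_congr rfl fun i _ => ?_
    have := rootFactor_pos (a := a) (hξ i)
    have h1 : ξ i ^ a = ξ i ^ (a - 1) * ξ i := by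
      rw [← pow_succ, Nat.sub_add_cancel (by omega)]
    field_simp
    rw [h1]
    ring
  rw [e1, e2]
  ring

lemma toCube_pos {k a : ℕ} {ξ : Fin k → ℝ} (hξ : ∀ i, 0 < ξ i) (i : Fin k) :
    0 < toCube k a ξ i :=
  mul_pos (div_pos (hξ i) (rootFactor_pos (hξ i))) (rootFactor_pos (hξ _))

lemma toCube_pow {k a : ℕ} (ha : a ≠ 0) {ξ : Fin k → ℝ} (hξ : ∀ i, 0 < ξ i) (i : Fin k) :
    toCube k a ξ i ^ a = ξ i ^ a / (1 + ξ i ^ a) * (1 + ξ (finRotate k i) ^ a) := by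
  rw [toCube, mul_pow, div_pow, rootFactor_pow ha (hξ _), rootFactor_pow ha (hξ _)]

lemma prod_toCube {k a : ℕ} {ξ : Fin k → ℝ} (hξ : ∀ i, 0 < ξ i) :
    ∏ i, toCube k a ξ i = ∏ i, ξ i := by
  simp only [toCube]
  rw [Finset.prod_mul_distrib, Equiv.prod_comp (finRotate k) (fun i => rootFactor a (ξ i)),
    ← Finset.prod_mul_distrib]
  exact Finset.prod_congr rfl fun i _ => div_mul_cancel₀ _ (rootFactor_pos (hξ i)).ne'

lemma toCube_lt_one_iff {k a : ℕ} (ha : a ≠ 0) {ξ : Fin k → ℝ} (hξ : ∀ i, 0 < ξ i)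
    (i : Fin k) : toCube k a ξ i < 1 ↔ ξ i * ξ (finRotate k i) < 1 := by
  rw [← pow_lt_one_iff_of_nonneg (toCube_pos hξ i).le ha, toCube_pow ha hξ,
    ← pow_lt_one_iff_of_nonneg (mul_pos (hξ i) (hξ _)).le ha, mul_pow, div_mul_eq_mul_div,
    div_lt_one (by have := hξ i; positivity)]
  constructor <;> intro h <;> linarith

/-- In terms of `u = ξ ^ a / (1 + ξ ^ a)` the substitution inverts the cyclic linear system
`u i = y i * (1 - u (i + 1))`, where `y i` is the `a`-th power of the new coordinate. -/
lemma toCube_pow_mul_one_sub {k a : ℕ} (ha : a ≠ 0) {ξ : Fin k → ℝ} (hξ : ∀ i, 0 < ξ i)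
    (i : Fin k) :
    ξ i ^ a / (1 + ξ i ^ a) = toCube k a ξ i ^ a *
      (1 - ξ (finRotate k i) ^ a / (1 + ξ (finRotate k i) ^ a)) := by
  rw [toCube_pow ha hξ]
  have h1 := pow_pos (hξ i) a
  have h2 := pow_pos (hξ (finRotate k i)) a
  field_simp
  ring

lemma injOn_toCube {k a : ℕ} (ha : a ≠ 0) : Set.InjOn (toCube k a) (openPolytope k) := by
  intro ξ hξ η hη h
  have hy : ∀ i, toCube k a ξ i ^ a ∈ Set.Ioo (0 : ℝ) 1 := fun i =>
    ⟨pow_pos (toCube_pos hξ.1 i) a, pow_lt_one₀ (toCube_pos hξ.1 i).le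
      ((toCube_lt_one_iff ha hξ.1 i).2 (hξ.2 i)) ha⟩
  have hd := eq_zero_of_add_mul_comp_eq_zero (finRotate k)
    (d := fun i => ξ i ^ a / (1 + ξ i ^ a) - η i ^ a / (1 + η i ^ a)) hy fun i => by
      have h1 := toCube_pow_mul_one_sub ha hξ.1 i
      have h2 := toCube_pow_mul_one_sub ha hη.1 i
      rw [← h] at h2
      linear_combination h1 - h2
  funext i
  have h1 : ξ i ^ a / (1 + ξ i ^ a) = η i ^ a / (1 + η i ^ a) := sub_eq_zero.1 (congrFun hd i)
  have p1 := pow_pos (hξ.1 i) a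
  have p2 := pow_pos (hη.1 i) a
  rw [div_eq_div_iff (by positivity) (by positivity)] at h1
  exact (pow_left_inj₀ (hξ.1 i).le (hη.1 i).le ha).1 (by linarith)

lemma image_toCube {k a : ℕ} (ha : a ≠ 0) :
    toCube k a '' openPolytope k = Set.univ.pi fun _ => Set.Ioo (0 : ℝ) 1 := by
  apply Set.Subset.antisymm
  · rintro _ ⟨ξ, hξ, rfl⟩ i -
    exact ⟨toCube_pos hξ.1 i, (toCube_lt_one_iff ha hξ.1 i).2 (hξ.2 i)⟩
  · intro x hx
    have hx' : ∀ i, x i ∈ Set.Ioo (0 : ℝ) 1 := fun i => hx i trivial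
    obtain ⟨u, hu, hux⟩ := exists_mem_Ioo_eq_mul_one_sub (finRotate k) (y := fun i => x i ^ a)
      fun i => ⟨pow_pos (hx' i).1 a, pow_lt_one₀ (hx' i).1.le (hx' i).2 ha⟩
    have hq : ∀ i, 0 < u i / (1 - u i) := fun i => div_pos (hu i).1 (sub_pos.2 (hu i).2)
    set ξ : Fin k → ℝ := fun i => (u i / (1 - u i)) ^ (1 / a : ℝ) with hξdef
    have hξ : ∀ i, 0 < ξ i := fun i => Real.rpow_pos_of_pos (hq i) _
    have hpow : ∀ i, ξ i ^ a = u i / (1 - u i) := fun i => by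
      rw [hξdef]
      dsimp only
      rw [← Real.rpow_natCast, ← Real.rpow_mul (hq i).le,
        one_div_mul_cancel (by exact_mod_cast ha), Real.rpow_one]
    have heq : toCube k a ξ = x := by
      funext i
      refine (pow_left_inj₀ (toCube_pos hξ i).le (hx' i).1.le ha).1 ?_
      rw [toCube_pow ha hξ, hpow, hpow]
      have h1 := sub_pos.2 (hu i).2
      have h2 := sub_pos.2 (hu (finRotate k i)).2
      have h3 := hux i
      have h4 : u i / (1 - u i) / (1 + u i / (1 - u i)) = u i := by
        field_simp
        ring
      have h5 : 1 + u (finRotate k i) / (1 - u (finRotate k i)) =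
          1 / (1 - u (finRotate k i)) := by
        field_simp
        ring
      rw [h4, h5, mul_one_div, div_eq_iff h2.ne']
      exact h3
    refine ⟨ξ, ⟨hξ, fun i => (toCube_lt_one_iff ha hξ i).1 ?_⟩, heq⟩
    rw [heq]
    exact (hx' i).2

lemma measurableSet_openPolytope (k : ℕ) : MeasurableSet (openPolytope k) := by
  have h1 : MeasurableSet {x : Fin k → ℝ | ∀ i, 0 < x i} := by
    simp only [Set.ofPred_forall]
    exact .iInter fun i => measurableSet_lt measurable_const (measurable_pi_apply _)
  have h2 : MeasurableSet {x : Fin k → ℝ | ∀ i, x i * x (finRotate k i) < 1} := by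
    simp only [Set.ofPred_forall]
    exact .iInter fun i =>
      measurableSet_lt (by fun_prop : Measurable fun x : Fin k → ℝ => x i * x (finRotate k i))
        measurable_const
  exact h1.inter h2

lemma prod_pow_mem_Ioo {k a : ℕ} (hk : 1 ≤ k) (ha : a ≠ 0) {x : Fin k → ℝ}
    (hx : ∀ i, x i ∈ Set.Ioo (0 : ℝ) 1) : ∏ i, x i ^ a ∈ Set.Ioo (0 : ℝ) 1 := by
  refine ⟨Finset.prod_pos fun i _ => pow_pos (hx i).1 a, ?_⟩
  have : Nonempty (Fin k) := ⟨⟨0, hk⟩⟩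
  calc ∏ i, x i ^ a < ∏ _i : Fin k, (1 : ℝ) :=
        Finset.prod_lt_prod_of_nonempty (fun i _ => pow_pos (hx i).1 a)
          (fun i _ => pow_lt_one₀ (hx i).1.le (hx i).2 ha) Finset.univ_nonempty
    _ = 1 := by simp

lemma one_sub_neg_one_pow_mul_pos (k : ℕ) {t : ℝ} (ht : t ∈ Set.Ioo (0 : ℝ) 1) :
    0 < 1 - (-1) ^ k * t := by
  rcases neg_one_pow_eq_or ℝ k with h | h <;> rw [h] <;> linarith [ht.1, ht.2]

/-- The Jacobian of the substitution cancels the denominator of the geometric series. -/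
lemma lintegral_cube_eq_lintegral_openPolytope {k a : ℕ} (hk : 1 ≤ k) (ha : a ≠ 0) (b : ℕ) :
    ∫⁻ x in Set.univ.pi fun _ : Fin k => Set.Ioo (0 : ℝ) 1,
        ENNReal.ofReal ((∏ i, x i ^ b) / (1 - (-1) ^ k * ∏ i, x i ^ a)) =
      ∫⁻ ξ in openPolytope k, ∏ i, ENNReal.ofReal (ξ i ^ b / (1 + ξ i ^ a)) := by
  rw [← image_toCube ha, lintegral_image_eq_lintegral_abs_det_fderiv_mul volume
    (measurableSet_openPolytope k)
    (fun ξ hξ => (hasFDerivAt_toCube ha hξ.1).hasFDerivWithinAt) (injOn_toCube ha)]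
  refine setLIntegral_congr_fun (measurableSet_openPolytope k) fun ξ hξ => ?_
  have hcube : ∀ i, toCube k a ξ i ∈ Set.Ioo (0 : ℝ) 1 := fun i =>
    ⟨toCube_pos hξ.1 i, (toCube_lt_one_iff ha hξ.1 i).2 (hξ.2 i)⟩
  have hprod : ∀ m, ∏ i, toCube k a ξ i ^ m = ∏ i, ξ i ^ m := fun m => by
    rw [Finset.prod_pow, prod_toCube hξ.1, Finset.prod_pow]
  have hpos := one_sub_neg_one_pow_mul_pos k (prod_pow_mem_Ioo hk ha hcube)
  rw [hprod] at hpos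
  have hden : ∀ i, 0 < 1 + ξ i ^ a := fun i => by have := pow_pos (hξ.1 i) a; positivity
  have hdet : (LinearMap.toContinuousLinearMap (Matrix.toLin' (toCubeJacobian k a ξ))).det =
      (∏ i, 1 / (1 + ξ i ^ a)) * (1 - (-1) ^ k * ∏ i, ξ i ^ a) := by
    rw [← det_toCubeJacobian hk ha hξ.1, ContinuousLinearMap.det]
    exact LinearMap.det_toLin' _
  have hdetpos : 0 < (∏ i, 1 / (1 + ξ i ^ a)) * (1 - (-1) ^ k * ∏ i, ξ i ^ a) :=
    mul_pos (Finset.prod_pos fun i _ => one_div_pos.2 (hden i)) hpos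
  rw [hdet, abs_of_pos hdetpos, hprod, hprod, ← ENNReal.ofReal_mul hdetpos.le,
    ← ENNReal.ofReal_prod_of_nonneg
      fun i _ => div_nonneg (pow_pos (hξ.1 i) b).le (hden i).le]
  congr 1
  rw [mul_assoc, mul_div_cancel₀ _ hpos.ne', ← Finset.prod_mul_distrib]
  exact Finset.prod_congr rfl fun i _ => by rw [one_div_mul_eq_div]

/-! ### The bilateral series -/

lemma pow_le_one_add_pow {m a : ℕ} (h : m ≤ a) {x : ℝ} (hx : 0 ≤ x) : x ^ m ≤ 1 + x ^ a := by
  rcases le_total x 1 with h1 | h1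
  · linarith [pow_le_one₀ (n := m) hx h1, pow_nonneg hx a]
  · linarith [pow_le_pow_right₀ h1 h]

lemma measurable_pow_div_one_add_pow (a b : ℕ) :
    Measurable fun x : ℝ => x ^ b / (1 + x ^ a) := by
  fun_prop

lemma integrableOn_pow_div_one_add_pow {a b : ℕ} (hab : b + 2 ≤ a) :
    IntegrableOn (fun x : ℝ => x ^ b / (1 + x ^ a)) (Set.Ioi 0) := by
  -- Both `x ^ b` and `x ^ (b + 2)` are at most `1 + x ^ a`, so `2 / (1 + x ^ 2)` dominates.
  refine Integrable.mono' ((integrable_inv_one_add_sq.const_mul 2).integrableOn (s := Set.Ioi 0))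
    (measurable_pow_div_one_add_pow a b).aestronglyMeasurable ?_
  filter_upwards [ae_restrict_mem measurableSet_Ioi] with x hx
  have hx : 0 < x := hx
  have h1 := pow_le_one_add_pow (m := b) (a := a) (by omega) hx.le
  have h2 := pow_le_one_add_pow hab hx.le
  rw [pow_add] at h2
  rw [Real.norm_of_nonneg (by positivity), ← div_eq_mul_inv,
    div_le_div_iff₀ (by positivity) (by positivity)]
  linarith

lemma integrableOn_const_mul_density {a b : ℕ} (hab : b + 2 ≤ a) (c : ℝ) :
    IntegrableOn (fun x : ℝ => c * (x ^ b / (1 + x ^ a))) (Set.Ioi 0) :=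
  (integrableOn_pow_div_one_add_pow hab).const_mul c

lemma pi_lawOf_polytope {k a b : ℕ} (hab : b + 2 ≤ a) {c : ℝ} (hc : 0 ≤ c) :
    (Measure.pi fun _ : Fin k => lawOf fun x => c * (x ^ b / (1 + x ^ a)))
        {x | ∀ i, x i * x (finRotate k i) < 1} =
      ENNReal.ofReal c ^ k *
        ∫⁻ ξ in openPolytope k, ∏ i, ENNReal.ofReal (ξ i ^ b / (1 + ξ i ^ a)) := by
  have hf := integrableOn_const_mul_density hab c
  have hae : (Measure.pi fun _ : Fin k => lawOf fun x => c * (x ^ b / (1 + x ^ a)))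
      {x | ∀ i, x i * x (finRotate k i) < 1} =
      (Measure.pi fun _ : Fin k => lawOf fun x => c * (x ^ b / (1 + x ^ a)))
        (openPolytope k) := by
    refine measure_congr ?_
    filter_upwards [ae_pos_pi_lawOf (ι := Fin k) hf] with x hx
    exact propext ⟨fun h => ⟨hx, h⟩, fun h => h.2⟩
  have hsub : openPolytope k ⊆ Set.univ.pi fun _ : Fin k => Set.Ioi (0 : ℝ) :=
    fun x hx i _ => hx.1 i
  rw [hae, pi_lawOf hf, withDensity_apply _ (measurableSet_openPolytope k),
    Measure.restrict_restrict (measurableSet_openPolytope k), Set.inter_eq_left.2 hsub,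
    ← lintegral_const_mul' _ _ (ENNReal.pow_ne_top ENNReal.ofReal_ne_top)]
  refine lintegral_congr fun ξ => ?_
  simp_rw [ENNReal.ofReal_mul hc]
  rw [Finset.prod_mul_distrib, Finset.prod_const, Finset.card_univ, Fintype.card_fin]

/-- The sum of the geometric series `∑ (∏ x ^ b) * ((-1) ^ k * ∏ x ^ a) ^ n` on the unit cube. -/
def cubeKernel (k a b : ℕ) (x : Fin k → ℝ) : ℝ :=
  (∏ i, x i ^ b) / (1 - (-1) ^ k * ∏ i, x i ^ a)

lemma measurable_cubeKernel (k a b : ℕ) : Measurable (cubeKernel k a b) := by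
  unfold cubeKernel
  fun_prop

lemma measurableSet_cube (k : ℕ) :
    MeasurableSet (Set.univ.pi fun _ : Fin k => Set.Ioo (0 : ℝ) 1) :=
  MeasurableSet.univ_pi fun _ => measurableSet_Ioo

lemma cubeKernel_nonneg {k a : ℕ} (hk : 1 ≤ k) (ha : a ≠ 0) (b : ℕ) {x : Fin k → ℝ}
    (hx : x ∈ Set.univ.pi fun _ : Fin k => Set.Ioo (0 : ℝ) 1) : 0 ≤ cubeKernel k a b x :=
  div_nonneg (Finset.prod_nonneg fun i _ => pow_nonneg (hx i trivial).1.le b)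
    (one_sub_neg_one_pow_mul_pos k (prod_pow_mem_Ioo hk ha fun i => hx i trivial)).le

/-- The kernel is integrable because the substitution turns its integral into the measure of a
set under a finite measure. -/
lemma integrableOn_cubeKernel {k a b : ℕ} (hk : 1 ≤ k) (hab : b + 2 ≤ a) :
    IntegrableOn (cubeKernel k a b) (Set.univ.pi fun _ : Fin k => Set.Ioo (0 : ℝ) 1) := by
  have ha : a ≠ 0 := by omega
  refine ⟨(measurable_cubeKernel k a b).aestronglyMeasurable, ?_⟩
  have hnn : 0 ≤ᵐ[volume.restrict (Set.univ.pi fun _ : Fin k => Set.Ioo (0 : ℝ) 1)]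
      cubeKernel k a b := by
    filter_upwards [ae_restrict_mem (measurableSet_cube k)] with x hx
    exact cubeKernel_nonneg hk ha b hx
  rw [hasFiniteIntegral_iff_ofReal hnn]
  simp only [cubeKernel]
  rw [lintegral_cube_eq_lintegral_openPolytope hk ha b]
  have h1 := pi_lawOf_polytope (k := k) hab zero_le_one
  have hfin := isFiniteMeasure_lawOf (integrableOn_const_mul_density hab 1)
  rw [ENNReal.ofReal_one, one_pow, one_mul] at h1
  rw [← h1]
  exact measure_lt_top _ _

lemma probPolytope_eq_integral {k a b : ℕ} (hk : 1 ≤ k) (hab : b + 2 ≤ a) {c : ℝ}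
    (hc : 0 ≤ c) :
    probPolytope k (fun x => c * (x ^ b / (1 + x ^ a))) =
      c ^ k * ∫ x in Set.univ.pi fun _ : Fin k => Set.Ioo (0 : ℝ) 1, cubeKernel k a b x := by
  have ha : a ≠ 0 := by omega
  have hnn : 0 ≤ᵐ[volume.restrict (Set.univ.pi fun _ : Fin k => Set.Ioo (0 : ℝ) 1)]
      cubeKernel k a b := by
    filter_upwards [ae_restrict_mem (measurableSet_cube k)] with x hx
    exact cubeKernel_nonneg hk ha b hx
  rw [probPolytope, Measure.real, pi_lawOf_polytope hab hc,
    ← lintegral_cube_eq_lintegral_openPolytope hk ha b, ENNReal.toReal_mul, ENNReal.toReal_pow,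
    ENNReal.toReal_ofReal hc, integral_eq_lintegral_of_nonneg_ae hnn
      (measurable_cubeKernel k a b).aestronglyMeasurable]
  rfl

lemma integral_cube_prod_pow (k m : ℕ) :
    IntegrableOn (fun x : Fin k → ℝ => ∏ i, x i ^ m)
        (Set.univ.pi fun _ : Fin k => Set.Ioo (0 : ℝ) 1) ∧
      ∫ x in Set.univ.pi fun _ : Fin k => Set.Ioo (0 : ℝ) 1, ∏ i, x i ^ m =
        1 / ((m : ℝ) + 1) ^ k := by
  have hint : IntegrableOn (fun t : ℝ => t ^ m) (Set.Ioo 0 1) :=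
    ((continuous_pow m).continuousOn.integrableOn_Icc).mono_set Set.Ioo_subset_Icc_self
  rw [IntegrableOn, volume_pi, Measure.restrict_pi_pi]
  refine ⟨Integrable.fintype_prod fun _ => hint, ?_⟩
  rw [integral_fintype_prod_eq_pow (fun t : ℝ => t ^ m), Fintype.card_fin,
    ← integral_Ioc_eq_integral_Ioo, ← intervalIntegral.integral_of_le zero_le_one, integral_pow]
  simp

/-- Half of the bilateral series as an integral over the unit cube, by dominated convergence of
the partial sums of a geometric series. -/
lemma tendsto_sum_range_integral_cubeKernel {k a b : ℕ} (hk : 1 ≤ k) (hab : b + 2 ≤ a) :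
    Tendsto (fun N : ℕ => ∑ n ∈ Finset.range N,
        ((-1 : ℝ) ^ k) ^ n / ((a * n + b : ℕ) + 1 : ℝ) ^ k) atTop
      (𝓝 (∫ x in Set.univ.pi fun _ : Fin k => Set.Ioo (0 : ℝ) 1, cubeKernel k a b x)) := by
  have ha : a ≠ 0 := by omega
  have hterm : ∀ (n : ℕ) (x : Fin k → ℝ),
      (∏ i, x i ^ b) * ((-1) ^ k * ∏ i, x i ^ a) ^ n =
        ((-1 : ℝ) ^ k) ^ n * ∏ i, x i ^ (a * n + b) := fun n x => by
    simp_rw [pow_add, pow_mul]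
    rw [Finset.prod_mul_distrib, mul_pow, ← Finset.prod_pow]
    ring
  have hsum : ∀ N : ℕ, ∑ n ∈ Finset.range N,
      ((-1 : ℝ) ^ k) ^ n / ((a * n + b : ℕ) + 1 : ℝ) ^ k =
      ∫ x in Set.univ.pi fun _ : Fin k => Set.Ioo (0 : ℝ) 1,
        ∑ n ∈ Finset.range N, (∏ i, x i ^ b) * ((-1) ^ k * ∏ i, x i ^ a) ^ n := fun N => by
    simp_rw [hterm]
    rw [integral_finsetSum _ fun n _ => (integral_cube_prod_pow k (a * n + b)).1.const_mul _]
    refine Finset.sum_congr rfl fun n _ => ?_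
    rw [integral_const_mul, (integral_cube_prod_pow k (a * n + b)).2, mul_one_div]
  simp_rw [hsum]
  have habs : ∀ x ∈ Set.univ.pi fun _ : Fin k => Set.Ioo (0 : ℝ) 1,
      |(-1 : ℝ) ^ k * ∏ i, x i ^ a| < 1 ∧ (-1 : ℝ) ^ k * ∏ i, x i ^ a ≠ 1 := fun x hx => by
    have h1 := prod_pow_mem_Ioo hk ha fun i => hx i trivial
    refine ⟨?_, (sub_pos.1 (one_sub_neg_one_pow_mul_pos k h1)).ne⟩
    rw [abs_mul, abs_pow, abs_neg, abs_one, one_pow, one_mul, abs_of_pos h1.1]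
    exact h1.2
  have hgeom : ∀ x ∈ Set.univ.pi fun _ : Fin k => Set.Ioo (0 : ℝ) 1, ∀ N : ℕ,
      ∑ n ∈ Finset.range N, (∏ i, x i ^ b) * ((-1) ^ k * ∏ i, x i ^ a) ^ n =
        cubeKernel k a b x * (1 - ((-1) ^ k * ∏ i, x i ^ a) ^ N) := fun x hx N => by
    rw [← Finset.mul_sum, geom_sum_eq (habs x hx).2, cubeKernel, ← neg_div_neg_eq, neg_sub,
      neg_sub]
    ring
  refine tendsto_integral_of_dominated_convergence (fun x => 2 * cubeKernel k a b x)
    (fun N => Measurable.aestronglyMeasurable (by fun_prop))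
    ((integrableOn_cubeKernel hk hab).const_mul 2) (fun N => ?_) ?_
  · filter_upwards [ae_restrict_mem (measurableSet_cube k)] with x hx
    rw [hgeom x hx, Real.norm_eq_abs, abs_mul, abs_of_nonneg (cubeKernel_nonneg hk ha b hx),
      mul_comm]
    refine mul_le_mul_of_nonneg_right ?_ (cubeKernel_nonneg hk ha b hx)
    have h1 : |((-1 : ℝ) ^ k * ∏ i, x i ^ a) ^ N| ≤ 1 := by
      rw [abs_pow]
      exact pow_le_one₀ (abs_nonneg _) (habs x hx).1.le
    have h2 := abs_le.1 h1
    rw [abs_le]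
    constructor <;> linarith [h2.1, h2.2]
  · filter_upwards [ae_restrict_mem (measurableSet_cube k)] with x hx
    simp_rw [hgeom x hx]
    have := (tendsto_pow_atTop_nhds_zero_of_abs_lt_one (habs x hx).1).const_sub 1
    simpa using this.const_mul (cubeKernel k a b x)

lemma sum_Icc_neg_eq (f : ℤ → ℝ) (M N : ℕ) :
    ∑ n ∈ Finset.Icc (-(M : ℤ)) (N : ℤ), f n =
      ∑ n ∈ Finset.range (N + 1), f n + ∑ n ∈ Finset.range M, f (-((n : ℤ) + 1)) := by
  induction M with
  | zero =>
    rw [Finset.sum_range_zero, add_zero]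
    symm
    refine Finset.sum_bij (fun n _ => (n : ℤ)) (fun n hn => ?_) (fun _ _ _ _ h => by simpa using h)
      (fun z hz => ?_) fun _ _ => rfl
    · simp only [Finset.mem_range] at hn
      simp only [Finset.mem_Icc]
      omega
    · simp only [Finset.mem_Icc] at hz
      exact ⟨z.toNat, by simp only [Finset.mem_range]; omega, by omega⟩
  | succ M ih =>
    have h : Finset.Icc (-((M + 1 : ℕ) : ℤ)) (N : ℤ) =
        insert (-((M : ℤ) + 1)) (Finset.Icc (-(M : ℤ)) (N : ℤ)) := by
      ext z
      simp only [Finset.mem_Icc, Finset.mem_insert]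
      omega
    rw [h, Finset.sum_insert (by simp), ih, Finset.sum_range_succ _ M]
    ring

lemma seriesTerm_natCast (k a n : ℕ) :
    seriesTerm k a n = ((-1 : ℝ) ^ k) ^ n / ((a * n + 0 : ℕ) + 1 : ℝ) ^ k := by
  rw [seriesTerm, ← pow_mul, mul_comm k n, ← Nat.cast_mul, zpow_natCast]
  push_cast
  ring_nf

/-- The sign of the base `1 - a * (n + 1)` cancels one of the factors `(-1) ^ k`. -/
lemma seriesTerm_neg_add_one {a : ℕ} (ha : 2 ≤ a) (k n : ℕ) :
    seriesTerm k a (-((n : ℤ) + 1)) =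
      ((-1 : ℝ) ^ k) ^ n / ((a * n + (a - 2) : ℕ) + 1 : ℝ) ^ k := by
  have h1 : ((a : ℝ) * ((-((n : ℤ) + 1) : ℤ) : ℝ) + 1) =
      -1 * (((a * n + (a - 2) : ℕ) : ℝ) + 1) := by
    push_cast [Nat.cast_sub ha]
    ring
  have h2 : (-1 : ℝ) ^ (-((n : ℤ) + 1) * (k : ℤ)) = ((-1 : ℝ) ^ k) ^ n * (-1) ^ k := by
    rw [← pow_succ, ← pow_mul, neg_mul, zpow_neg, ← inv_zpow, inv_neg_one, mul_comm k,
      ← zpow_natCast]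
    push_cast
    rfl
  have h3 : (-1 : ℝ) ^ k ≠ 0 := pow_ne_zero _ (by norm_num)
  rw [seriesTerm, h1, h2, mul_pow, mul_comm, mul_div_mul_left _ _ h3]

lemma summable_half_series {k a : ℕ} (hk : 2 ≤ k) (ha : 1 ≤ a) (b : ℕ) :
    Summable fun n : ℕ => ((-1 : ℝ) ^ k) ^ n / ((a * n + b : ℕ) + 1 : ℝ) ^ k := by
  have hs : Summable fun n : ℕ => 1 / ((n + 1 : ℕ) : ℝ) ^ 2 :=
    (summable_nat_add_iff 1).2 (Real.summable_one_div_nat_pow.2 one_lt_two)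
  refine Summable.of_norm_bounded hs fun n => ?_
  rw [norm_div, norm_pow, norm_pow, norm_neg, norm_one, one_pow, one_pow,
    Real.norm_of_nonneg (by positivity)]
  have h1 : ((n + 1 : ℕ) : ℝ) ≤ ((a * n + b : ℕ) + 1 : ℝ) := by
    have : n + 1 ≤ a * n + b + 1 := by nlinarith
    exact_mod_cast this
  have h2 : (1 : ℝ) ≤ ((n + 1 : ℕ) : ℝ) := by exact_mod_cast Nat.succ_pos n
  refine one_div_le_one_div_of_le (by positivity) ?_
  exact (pow_le_pow_left₀ (by positivity) h1 2).trans (pow_le_pow_right₀ (h2.trans h1) hk)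

theorem mainTheorem1 (k a : ℕ) (hk : 1 ≤ k) (ha : 2 ≤ a) :
    Tendsto
        (fun p : ℕ × ℕ => ∑ n ∈ Finset.Icc (-(p.1 : ℤ)) (p.2 : ℤ), seriesTerm k a n)
        atTop
        (𝓝 ((Real.pi / a * (Real.sin (Real.pi / a))⁻¹) ^ k * giganticSum k a)) ∧
      (2 ≤ k →
        HasSum (fun n : ℤ => seriesTerm k a n)
          ((Real.pi / a * (Real.sin (Real.pi / a))⁻¹) ^ k * giganticSum k a)) ∧
      probPolytope k (fXi a) + probPolytope k (fTheta a) = giganticSum k a := by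
  have ha0 : (0 : ℝ) < a := by exact_mod_cast (by omega : 0 < a)
  have hsin : 0 < Real.sin (Real.pi / a) := by
    refine Real.sin_pos_of_pos_of_lt_pi (by positivity) ?_
    rw [div_lt_iff₀ ha0]
    have : (2 : ℝ) ≤ a := by exact_mod_cast ha
    nlinarith [Real.pi_pos]
  set c : ℝ := (a : ℝ) / Real.pi * Real.sin (Real.pi / a) with hc
  have hcpos : 0 < c := mul_pos (div_pos ha0 Real.pi_pos) hsin
  have hXi : fXi a = fun x => c * (x ^ 0 / (1 + x ^ a)) := by
    funext x
    rw [fXi, pow_zero, mul_one_div]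
  have hTheta : fTheta a = fun x => c * (x ^ (a - 2) / (1 + x ^ a)) := by
    funext x
    rw [fTheta, mul_div_assoc]
  have hprob : ∀ b, b + 2 ≤ a → probPolytope k (fun x => c * (x ^ b / (1 + x ^ a))) =
      cdfOf (fun x => c * (x ^ b / (1 + x ^ a))) 1 ^ k +
        ∑ n ∈ Finset.Icc 1 (k / 2), ∑ r ∈ nonconsecTuples k n,
          tupleIntegral (fun x => c * (x ^ b / (1 + x ^ a))) r := fun b hb =>
    probPolytope_eq_sum k ((measurable_pow_div_one_add_pow a b).const_mul c)
      (fun x hx => by positivity) (integrableOn_const_mul_density hb c)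
  have hG : probPolytope k (fXi a) + probPolytope k (fTheta a) = giganticSum k a := by
    rw [giganticSum, hXi, hTheta, hprob 0 (by omega), hprob (a - 2) (by omega)]
    simp only [Finset.sum_add_distrib, cdfOf]
    ring
  have hlim : (Real.pi / a * (Real.sin (Real.pi / a))⁻¹) ^ k * giganticSum k a =
      (∫ x in Set.univ.pi fun _ : Fin k => Set.Ioo (0 : ℝ) 1, cubeKernel k a 0 x) +
        ∫ x in Set.univ.pi fun _ : Fin k => Set.Ioo (0 : ℝ) 1, cubeKernel k a (a - 2) x := by
    have h1 : Real.pi / a * (Real.sin (Real.pi / a))⁻¹ * c = 1 := by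
      rw [hc]
      have := Real.pi_pos
      field_simp
    rw [← hG, hXi, hTheta, probPolytope_eq_integral hk (by omega) hcpos.le,
      probPolytope_eq_integral hk (by omega) hcpos.le, ← mul_add, ← mul_assoc, ← mul_pow, h1,
      one_pow, one_mul]
  have hpos := tendsto_sum_range_integral_cubeKernel (b := 0) hk ha
  have hneg := tendsto_sum_range_integral_cubeKernel (b := a - 2) hk (by omega : a - 2 + 2 ≤ a)
  simp_rw [← seriesTerm_natCast] at hpos
  simp_rw [← seriesTerm_neg_add_one ha] at hneg
  rw [hlim]
  refine ⟨?_, fun hk2 => ?_, hG⟩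
  · simp_rw [sum_Icc_neg_eq]
    rw [← prod_atTop_atTop_eq]
    exact (((tendsto_add_atTop_iff_nat 1).2 hpos).comp tendsto_snd).add (hneg.comp tendsto_fst)
  · have hs1 := summable_half_series hk2 (by omega : 1 ≤ a) 0
    have hs2 := summable_half_series hk2 (by omega : 1 ≤ a) (a - 2)
    simp_rw [← seriesTerm_natCast] at hs1
    simp_rw [← seriesTerm_neg_add_one ha] at hs2
    exact HasSum.of_nat_of_neg_add_one
      ((hs1.hasSum_iff_tendsto_nat).2 hpos) ((hs2.hasSum_iff_tendsto_nat).2 hneg)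

end
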